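/- Let $f_1,\dots,f_m:\mathbb R^n\to\mathbb R$ be convex and let $X_1,\dots,X_m\subset\mathbb R^n$ be compact and convex, with $\bigcap_{i=1}^m X_i$ having non-empty interior. Put $f=\sum_{i=1}^m f_i$ and suppose that the subgradients of $f$ are bounded on $\bigcup_{i=1}^m X_i$, i.e. there is $L<\infty$ with $\|\xi\|_2\le L$ for all $x\in\bigcup_{i} X_i$ and $\xi\in\partial f(x)$. Consider the problem $$\text{minimise } f(x)\quad\text{subject to } x\in\textstyle\bigcap_{i=1}^m X_i .\qquad(\mathrm P)$$ For $k=0,1,2,\dots$ let $A(k)$ be a real $m\times m$ matrix, with $[A(k)]^i_j$ its entry in row $j$ and column $i$. Agent $j$ sends information to agent $i$ at time $k$ if $[A(k)]_j^i>0$; let $\mathcal E_\infty$ be the set of pairs $(j,i)$ such that $j$ sends information to $i$ at infinitely many times $k$. Assume that: (i) the directed graph $(\{1,\dots,m\},\mathcal E_\infty)$ is strongly connected, and there is $T\in\mathbb N$ such that for each $(j,i)\in\mathcal E_\infty$, agent $j$ sends information to agent $i$ at least once in every $T$ consecutive iterations; (ii) there is $\eta\in(0,1)$ such that, for all $k,i,j$,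 $[A(k)]_i^i\ge\eta$, and $[A(k)]_j^i\ge\eta$ whenever $[A(k)]_j^i>0$; (iii) each $A(k)$ is doubly stochastic. Let $(c(k))_{k\ge0}$ be non-negative and non-increasing with $\sum_k c(k)=\infty$ and $\sum_k c(k)^2<\infty$ (for example $c(k)=\beta/(k+1)$ with $\beta>0$). Starting from arbitrary $x_i(0)\in X_i$, let the sequences satisfy, for all $k\ge0$ and $i=1,\dots,m$, $$z_i(k)=\sum_{j=1}^m[A(k)]_j^i\,x_j(k),\qquad g_i(k)\in\partial f_i(z_i(k)),\qquad d_i(k)=\sum_{j=1}^m[A(k)]_j^i\,g_j(k),$$ $$x_i(k+1)=\operatorname*{arg\,min}_{\xi\in X_i}\ d_i(k)^{T}\xi+\frac1{2c(k)}\|z_i(k)-\xi\|_2^2 .$$ Then there is a minimiser $x^\star$ of $(\mathrm P)$, the same for all agents, such that $$\lim_{k\to\infty}\|x_i(k)-x^\star\|_2=0\qquad\text{for all } i=1,\dots,m.$$ -/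

import Mathlib

open Filter Topology

namespace SubgradAvg

/-- The subdifferential `∂h(x)` of a real-valued function `h` on `ℝⁿ`: the set of all `g` with
`h x + ⟨g, y - x⟩ ≤ h y` for every `y`. -/
def subdifferential {n : ℕ} (h : EuclideanSpace ℝ (Fin n) → ℝ) (x : EuclideanSpace ℝ (Fin n)) :
    Set (EuclideanSpace ℝ (Fin n)) :=
  {g | ∀ y, h x + inner ℝ g (y - x) ≤ h y}

/-- The global objective `f = ∑ i, f i`. -/
noncomputable def objective {n m : ℕ} (f : Fin m → EuclideanSpace ℝ (Fin n) → ℝ)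
    (x : EuclideanSpace ℝ (Fin n)) : ℝ :=
  ∑ i, f i x

/-- `xs` is a minimiser of `f = ∑ i, f i` over the feasible set `⋂ i, X i`. -/
def IsMinimiser {n m : ℕ} (f : Fin m → EuclideanSpace ℝ (Fin n) → ℝ)
    (X : Fin m → Set (EuclideanSpace ℝ (Fin n))) (xs : EuclideanSpace ℝ (Fin n)) : Prop :=
  xs ∈ ⋂ i, X i ∧ ∀ y ∈ ⋂ i, X i, objective f xs ≤ objective f y

/-- Standing assumptions on the optimisation problem. -/
structure ProblemAssumptions {n m : ℕ} (f : Fin m → EuclideanSpace ℝ (Fin n) → ℝ)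
    (X : Fin m → Set (EuclideanSpace ℝ (Fin n))) : Prop where
  convex_objective : ∀ i, ConvexOn ℝ Set.univ (f i)
  compact_set : ∀ i, IsCompact (X i)
  convex_set : ∀ i, Convex ℝ (X i)
  interior_nonempty : (interior (⋂ i, X i)).Nonempty
  bounded_subgradient :
    ∃ L : ℝ, ∀ x ∈ ⋃ i, X i, ∀ ξ ∈ subdifferential (objective f) x, ‖ξ‖ ≤ L

/-- Agent `j` sends information to agent `i` at time `k`, i.e. `(j, i)` is an edge of the
communication graph at time `k`. The weight `A k j i` is the entry in row `j` and column `i`,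
the one agent `i` gives to the information received from agent `j`. -/
def Communicates {m : ℕ} (A : ℕ → Matrix (Fin m) (Fin m) ℝ) (k : ℕ) (j i : Fin m) : Prop :=
  0 < A k j i

/-- Edges of the limit graph: agent `j` communicates with agent `i` infinitely often. -/
def LimitEdge {m : ℕ} (A : ℕ → Matrix (Fin m) (Fin m) ℝ) (j i : Fin m) : Prop :=
  ∃ᶠ k in atTop, Communicates A k j i

/-- Standing assumptions on the time-varying network and its weights. -/
structure NetworkAssumptions {m : ℕ} (A : ℕ → Matrix (Fin m) (Fin m) ℝ) : Prop where
  /-- The limit graph is strongly connected: a directed path leads from any agent to any other. -/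
  strongly_connected : ∀ j i, Relation.ReflTransGen (LimitEdge A) j i
  /-- Uniform bound `T` on the communication time: every edge of the limit graph is active at
  least once in any `T` consecutive iterations. -/
  bounded_communication : ∃ T : ℕ, ∀ j i, LimitEdge A j i →
    ∀ k, ∃ l, k ≤ l ∧ l < k + T ∧ Communicates A l j i
  weights_bounded_below : ∃ η : ℝ, 0 < η ∧ η < 1 ∧ ∀ k,
    (∀ i, η ≤ A k i i) ∧ ∀ j i, 0 < A k j i → η ≤ A k j i
  doubly_stochastic : ∀ k, A k ∈ doublyStochastic ℝ (Fin m)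

/-- Standing assumptions on the step sizes. -/
structure StepSizeAssumptions (c : ℕ → ℝ) : Prop where
  nonneg : ∀ k, 0 ≤ c k
  nonincreasing : Antitone c
  not_summable : ¬ Summable c
  square_summable : Summable fun k => c k ^ 2

/-- `x`, `z`, `g`, `d` are sequences generated by the subgradient-averaging algorithm: `x k i` is
the iterate of agent `i` at time `k`, `z k i` its average, `g k i` the subgradient of `f i` it
picks at `z k i`, and `d k i` the averaged subgradient. -/
structure IsRun {n m : ℕ} (f : Fin m → EuclideanSpace ℝ (Fin n) → ℝ)
    (X : Fin m → Set (EuclideanSpace ℝ (Fin n))) (A : ℕ → Matrix (Fin m) (Fin m) ℝ)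
    (c : ℕ → ℝ) (x z g d : ℕ → Fin m → EuclideanSpace ℝ (Fin n)) : Prop where
  init : ∀ i, x 0 i ∈ X i
  average : ∀ k i, z k i = ∑ j, A k j i • x k j
  subgradient : ∀ k i, g k i ∈ subdifferential (f i) (z k i)
  average_subgradient : ∀ k i, d k i = ∑ j, A k j i • g k j
  update_mem : ∀ k i, x (k + 1) i ∈ X i
  /-- `x (k + 1) i` minimises `ξ ↦ ⟨d k i, ξ⟩ + ‖z k i - ξ‖² / (2 c k)` over `X i`. -/
  update_min : ∀ k i, ∀ ξ ∈ X i,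
    inner ℝ (d k i) (x (k + 1) i) + 1 / (2 * c k) * ‖z k i - x (k + 1) i‖ ^ 2 ≤
      inner ℝ (d k i) ξ + 1 / (2 * c k) * ‖z k i - ξ‖ ^ 2

end SubgradAvg

namespace SubgradAvg

section Averaging

variable {ι V : Type*} [Fintype ι] [NormedAddCommGroup V]

/-- The largest distance between two members of a finite family. -/
noncomputable def spread (y : ι → V) : ℝ := ‖fun p : ι × ι => y p.1 - y p.2‖

lemma spread_nonneg (y : ι → V) : 0 ≤ spread y := norm_nonneg _

lemma norm_sub_le_spread (y : ι → V) (i j : ι) : ‖y i - y j‖ ≤ spread y :=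
  norm_le_pi_norm (fun p : ι × ι => y p.1 - y p.2) (i, j)

lemma spread_le {y : ι → V} {r : ℝ} (hr : 0 ≤ r) (h : ∀ i j, ‖y i - y j‖ ≤ r) : spread y ≤ r :=
  (pi_norm_le_iff_of_nonneg hr).2 fun p => h p.1 p.2

lemma spread_add_le (y e : ι → V) : spread (y + e) ≤ spread y + 2 * ‖e‖ := by
  refine spread_le (add_nonneg (spread_nonneg y) (by positivity)) fun i j => ?_
  have h : (y + e) i - (y + e) j = (y i - y j) + (e i - e j) := by
    simp only [Pi.add_apply]; abel
  rw [h]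
  have h1 := norm_add_le (y i - y j) (e i - e j)
  have h2 := norm_sub_le (e i) (e j)
  linarith [norm_sub_le_spread y i j, norm_le_pi_norm e i, norm_le_pi_norm e j]

variable [NormedSpace ℝ V]

/-- The weighted averages `i ↦ ∑ j, B j i • y j`. -/
def average (B : Matrix ι ι ℝ) (y : ι → V) : ι → V := fun i => ∑ j, B j i • y j

lemma average_add (B : Matrix ι ι ℝ) (y w : ι → V) :
    average B (y + w) = average B y + average B w := by
  ext i
  simp [average, Finset.sum_add_distrib]

lemma average_mul (B C : Matrix ι ι ℝ) (y : ι → V) :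
    average (B * C) y = average C (average B y) := by
  ext i
  simp only [average, Matrix.mul_apply, Finset.sum_smul, Finset.smul_sum, smul_smul]
  rw [Finset.sum_comm]
  simp only [mul_comm]

lemma average_one [DecidableEq ι] (y : ι → V) : average (1 : Matrix ι ι ℝ) y = y := by
  ext i
  simp [average, Matrix.one_apply]

lemma norm_average_le {B : Matrix ι ι ℝ} (h0 : ∀ i j, 0 ≤ B i j) (h1 : ∀ i, ∑ j, B j i = 1)
    (y : ι → V) : ‖average B y‖ ≤ ‖y‖ := by
  refine (pi_norm_le_iff_of_nonneg (norm_nonneg _)).2 fun i => ?_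
  calc ‖∑ j, B j i • y j‖ ≤ ∑ j, B j i * ‖y‖ := by
        refine norm_sum_le_of_le _ fun j _ => ?_
        rw [norm_smul, Real.norm_of_nonneg (h0 j i)]
        exact mul_le_mul_of_nonneg_left (norm_le_pi_norm y j) (h0 j i)
    _ = ‖y‖ := by rw [← Finset.sum_mul, h1, one_mul]

lemma average_sub_const {B : Matrix ι ι ℝ} (h1 : ∀ i, ∑ j, B j i = 1) (y : ι → V) (a : V) (i : ι) :
    average B y i - a = ∑ j, B j i • (y j - a) := by
  simp only [average, smul_sub, Finset.sum_sub_distrib, ← Finset.sum_smul, h1, one_smul]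

lemma spread_average_le {B : Matrix ι ι ℝ} {δ : ℝ} (hδ : 0 ≤ δ) (hB : ∀ i j, δ ≤ B i j)
    (h1 : ∀ i, ∑ j, B j i = 1) (y : ι → V) : spread (average B y) ≤ (1 - δ) * spread y := by
  classical
  have h0 : ∀ i j, 0 ≤ B i j := fun i j => hδ.trans (hB i j)
  rcases isEmpty_or_nonempty ι with hι | ⟨⟨i₀⟩⟩
  · have h : ∀ w : ι → V, spread w = 0 := fun w =>
      le_antisymm (spread_le le_rfl fun i => hι.elim i) (spread_nonneg w)
    simp [h]
  have hδ1 : δ ≤ 1 := (hB i₀ i₀).trans <| by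
    rw [← h1 i₀]
    exact Finset.single_le_sum (fun j _ => h0 j i₀) (Finset.mem_univ i₀)
  refine spread_le (mul_nonneg (by linarith) (spread_nonneg y)) fun i i' => ?_
  have key : average B y i - average B y i' = ∑ l, ∑ l', (B l i * B l' i') • (y l - y l') := by
    rw [average_sub_const h1]
    refine Finset.sum_congr rfl fun l _ => ?_
    rw [← neg_sub, average_sub_const h1, ← Finset.sum_neg_distrib, Finset.smul_sum]
    refine Finset.sum_congr rfl fun l' _ => ?_
    rw [← smul_neg, neg_sub, smul_smul]
  have hterm : ∀ l l', ‖(B l i * B l' i') • (y l - y l')‖ ≤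
      (B l i * B l' i' - if l = l' then B l i * B l i' else 0) * spread y := by
    intro l l'
    split_ifs with h
    · subst h; simp
    · rw [norm_smul, Real.norm_of_nonneg (mul_nonneg (h0 _ _) (h0 _ _)), sub_zero]
      exact mul_le_mul_of_nonneg_left (norm_sub_le_spread y l l') (mul_nonneg (h0 _ _) (h0 _ _))
  calc ‖average B y i - average B y i'‖
      ≤ ∑ l, ∑ l', (B l i * B l' i' - if l = l' then B l i * B l i' else 0) * spread y := by
        rw [key]
        exact norm_sum_le_of_le _ fun l _ => norm_sum_le_of_le _ fun l' _ => hterm l l'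
    _ = (1 - ∑ l, B l i * B l i') * spread y := by
        simp only [← Finset.sum_mul, Finset.sum_sub_distrib, ← Finset.mul_sum, h1]
        simp
    _ ≤ (1 - δ) * spread y := by
        refine mul_le_mul_of_nonneg_right (sub_le_sub_left ?_ 1) (spread_nonneg y)
        calc δ = ∑ l, B l i * δ := by rw [← Finset.sum_mul, h1, one_mul]
          _ ≤ _ := Finset.sum_le_sum fun l _ => mul_le_mul_of_nonneg_left (hB _ _) (h0 _ _)

lemma sum_norm_average_sub_sq_le {B : Matrix ι ι ℝ} (h0 : ∀ i j, 0 ≤ B i j)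
    (h1 : ∀ i, ∑ j, B j i = 1) (h2 : ∀ j, ∑ i, B j i = 1) (y : ι → V) (a : V) :
    ∑ i, ‖average B y i - a‖ ^ 2 ≤ ∑ j, ‖y j - a‖ ^ 2 := by
  have hconv : ConvexOn ℝ Set.univ fun v : V => ‖v‖ ^ 2 :=
    convexOn_univ_norm.pow (fun _ _ => norm_nonneg _) 2
  calc ∑ i, ‖average B y i - a‖ ^ 2 ≤ ∑ i, ∑ j, B j i * ‖y j - a‖ ^ 2 := by
        refine Finset.sum_le_sum fun i _ => ?_
        rw [average_sub_const h1]
        exact hconv.map_sum_le (fun j _ => h0 j i) (h1 i) fun _ _ => Set.mem_univ _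
    _ = ∑ j, ‖y j - a‖ ^ 2 := by
        rw [Finset.sum_comm]
        simp only [← Finset.sum_mul, h2, one_mul]

end Averaging

section Consensus

variable {m : ℕ}

/-- The product `A k * A (k + 1) * ⋯ * A (k + s - 1)`. -/
noncomputable def transition (A : ℕ → Matrix (Fin m) (Fin m) ℝ) (k : ℕ) :
    ℕ → Matrix (Fin m) (Fin m) ℝ
  | 0 => 1
  | s + 1 => transition A k s * A (k + s)

lemma transition_mem {A : ℕ → Matrix (Fin m) (Fin m) ℝ}
    (hA : ∀ k, A k ∈ doublyStochastic ℝ (Fin m)) (k s : ℕ) :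
    transition A k s ∈ doublyStochastic ℝ (Fin m) := by
  induction s with
  | zero => exact one_mem _
  | succ s ih => exact mul_mem ih (hA _)

lemma pow_le_transition_succ {A : ℕ → Matrix (Fin m) (Fin m) ℝ}
    (hA : ∀ k, A k ∈ doublyStochastic ℝ (Fin m)) {η : ℝ} (hη : 0 < η) {k s : ℕ} {j i l : Fin m}
    (h : η ^ s ≤ transition A k s j i) (h' : η ≤ A (k + s) i l) :
    η ^ (s + 1) ≤ transition A k (s + 1) j l := by
  calc η ^ (s + 1) = η ^ s * η := pow_succ _ _
    _ ≤ transition A k s j i * A (k + s) i l :=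
        mul_le_mul h h' hη.le ((pow_pos hη s).le.trans h)
    _ ≤ _ := by
        rw [transition, Matrix.mul_apply]
        exact Finset.single_le_sum (f := fun i => transition A k s j i * A (k + s) i l)
          (fun i _ => mul_nonneg (nonneg_of_mem_doublyStochastic (transition_mem hA k s))
            (nonneg_of_mem_doublyStochastic (hA _))) (Finset.mem_univ i)

lemma pow_le_transition_of_le {A : ℕ → Matrix (Fin m) (Fin m) ℝ}
    (hA : ∀ k, A k ∈ doublyStochastic ℝ (Fin m)) {η : ℝ} (hη : 0 < η)
    (hd : ∀ k i, η ≤ A k i i) {k s t : ℕ} {j i : Fin m}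
    (h : η ^ s ≤ transition A k s j i) (hst : s ≤ t) : η ^ t ≤ transition A k t j i := by
  induction t, hst using Nat.le_induction with
  | base => exact h
  | succ t _ ih => exact pow_le_transition_succ hA hη ih (hd _ _)

lemma NetworkAssumptions.exists_window {A : ℕ → Matrix (Fin m) (Fin m) ℝ}
    (hA : NetworkAssumptions A) :
    ∃ S : ℕ, ∃ δ : ℝ, 0 < δ ∧ δ < 1 ∧ ∀ k j i, δ ≤ transition A k (S + 1) j i := by
  obtain ⟨η, hη, hη1, hw⟩ := hA.weights_bounded_below
  obtain ⟨T, hT⟩ := hA.bounded_communication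
  have hds := hA.doubly_stochastic
  have hd : ∀ k i, η ≤ A k i i := fun k => (hw k).1
  have claim : ∀ j i, ∃ S, ∀ k, η ^ S ≤ transition A k S j i := by
    intro j i
    induction hA.strongly_connected j i with
    | refl => exact ⟨0, fun k => by simp [transition]⟩
    | @tail i l _ hil ih =>
      obtain ⟨S, hS⟩ := ih
      refine ⟨S + T, fun k => ?_⟩
      obtain ⟨t, ht1, ht2, ht⟩ := hT i l hil (k + S)
      obtain ⟨r, rfl⟩ := Nat.exists_eq_add_of_le (show k ≤ t by omega)
      have h1 := pow_le_transition_of_le hds hη hd (hS k) (show S ≤ r by omega)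
      have h2 := pow_le_transition_succ hds hη h1 ((hw _).2 _ _ ht)
      exact pow_le_transition_of_le hds hη hd h2 (by omega)
  choose S hS using claim
  refine ⟨∑ j, ∑ i, S j i, η ^ ((∑ j, ∑ i, S j i) + 1), by positivity,
    pow_lt_one₀ hη.le hη1 (by omega), fun k j i => ?_⟩
  refine pow_le_transition_of_le hds hη hd (hS j i k) ?_
  have h1 := Finset.single_le_sum (f := fun i => S j i) (fun i _ => Nat.zero_le _)
    (Finset.mem_univ i)
  have h2 := Finset.single_le_sum (f := fun j => ∑ i, S j i) (fun i _ => Nat.zero_le _)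
    (Finset.mem_univ j)
  omega

lemma exists_eq_average_transition_add {V : Type*} [NormedAddCommGroup V] [NormedSpace ℝ V]
    {A : ℕ → Matrix (Fin m) (Fin m) ℝ} (hA : ∀ k, A k ∈ doublyStochastic ℝ (Fin m))
    {x e : ℕ → Fin m → V} (hx : ∀ k, x (k + 1) = average (A k) (x k) + e k) (k s : ℕ) :
    ∃ w, x (k + s) = average (transition A k s) (x k) + w ∧
      ‖w‖ ≤ ∑ r ∈ Finset.range s, ‖e (k + r)‖ := by
  induction s with
  | zero => exact ⟨0, by simp [transition, average_one]⟩
  | succ s ih =>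
    obtain ⟨w, hw, hle⟩ := ih
    refine ⟨average (A (k + s)) w + e (k + s), ?_, ?_⟩
    · rw [← add_assoc, hx, hw, average_add, transition, average_mul, add_assoc]
    · rw [Finset.sum_range_succ]
      refine (norm_add_le _ _).trans (add_le_add_left ?_ _)
      exact (norm_average_le (fun i j => nonneg_of_mem_doublyStochastic (hA _))
        (fun i => sum_col_of_mem_doublyStochastic (hA _) i) w).trans hle

lemma exists_sum_le_of_window_contraction {a b : ℕ → ℝ} (ha : ∀ k, 0 ≤ a k) (hb : ∀ k, 0 ≤ b k)
    {S : ℕ} {δ C : ℝ} (hδ : 0 < δ) (hδ1 : δ ≤ 1) (hC : 0 ≤ C)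
    (h : ∀ k, a (k + (S + 1)) ≤ (1 - δ) * a k + C * ∑ r ∈ Finset.range (S + 1), b (k + r)) :
    ∃ M, 0 < M ∧ ∀ N, ∑ k ∈ Finset.range (N + 1), a k ≤
      M * (1 + ∑ k ∈ Finset.range N, b k) := by
  set c₀ := ∑ k ∈ Finset.range (S + 1), a k
  have hc₀ : 0 ≤ c₀ := Finset.sum_nonneg fun k _ => ha k
  refine ⟨(c₀ + C * (S + 1) + δ) / δ, by positivity, fun N => ?_⟩
  have hbN : 0 ≤ ∑ k ∈ Finset.range N, b k := Finset.sum_nonneg fun k _ => hb k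
  suffices hs : δ * ∑ k ∈ Finset.range (N + 1), a k ≤
      c₀ + C * (S + 1) * ∑ k ∈ Finset.range N, b k by
    rw [div_mul_eq_mul_div, le_div_iff₀ hδ]
    nlinarith [mul_nonneg hc₀ hbN, mul_nonneg hδ.le hbN, mul_nonneg hC (Nat.cast_nonneg (α := ℝ) S)]
  rcases le_total N S with hN | hN
  · have h1 : ∑ k ∈ Finset.range (N + 1), a k ≤ c₀ :=
      Finset.sum_le_sum_of_subset_of_nonneg (Finset.range_mono (by omega)) fun k _ _ => ha k
    have h2 : 0 ≤ ∑ k ∈ Finset.range (N + 1), a k := Finset.sum_nonneg fun k _ => ha k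
    have h3 : 0 ≤ C * (S + 1) * ∑ k ∈ Finset.range N, b k := by positivity
    nlinarith
  · obtain ⟨M, rfl⟩ := Nat.exists_eq_add_of_le hN
    have hsplit : ∑ k ∈ Finset.range (S + M + 1), a k =
        c₀ + ∑ k ∈ Finset.range M, a (k + (S + 1)) := by
      rw [show S + M + 1 = (S + 1) + M by omega, Finset.sum_range_add]
      simp only [add_comm, c₀]
    have hwin : ∑ k ∈ Finset.range M, ∑ r ∈ Finset.range (S + 1), b (k + r) ≤
        (S + 1) * ∑ k ∈ Finset.range (S + M), b k := by
      rw [Finset.sum_comm]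
      calc _ ≤ ∑ r ∈ Finset.range (S + 1), ∑ k ∈ Finset.range (S + M), b k := by
            refine Finset.sum_le_sum fun r hr => ?_
            have hr' : r ≤ S := by simpa [Nat.lt_succ_iff] using hr
            calc ∑ k ∈ Finset.range M, b (k + r) ≤ ∑ k ∈ Finset.range (r + M), b k := by
                  rw [Finset.sum_range_add]
                  simp only [add_comm r]
                  exact le_add_of_nonneg_left (Finset.sum_nonneg fun k _ => hb k)
              _ ≤ _ := Finset.sum_le_sum_of_subset_of_nonneg
                  (Finset.range_mono (by omega)) fun k _ _ => hb k
        _ = _ := by simp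
    have hshift : ∑ k ∈ Finset.range M, a (k + (S + 1)) ≤
        (1 - δ) * ∑ k ∈ Finset.range M, a k +
          C * ((S + 1) * ∑ k ∈ Finset.range (S + M), b k) := by
      calc _ ≤ ∑ k ∈ Finset.range M, ((1 - δ) * a k + C * ∑ r ∈ Finset.range (S + 1), b (k + r)) :=
            Finset.sum_le_sum fun k _ => h k
        _ = (1 - δ) * ∑ k ∈ Finset.range M, a k +
            C * ∑ k ∈ Finset.range M, ∑ r ∈ Finset.range (S + 1), b (k + r) := by
            rw [Finset.sum_add_distrib, Finset.mul_sum, Finset.mul_sum]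
        _ ≤ _ := add_le_add_right (mul_le_mul_of_nonneg_left hwin hC) _
    have hmono : ∑ k ∈ Finset.range M, a k ≤ ∑ k ∈ Finset.range (S + M + 1), a k :=
      Finset.sum_le_sum_of_subset_of_nonneg (Finset.range_mono (by omega)) fun k _ _ => ha k
    have := mul_le_mul_of_nonneg_left hmono (sub_nonneg.2 hδ1)
    linarith

/-- In a consensus iteration with perturbations `e`, the squared disagreements are controlled by the
squared perturbations. -/
lemma NetworkAssumptions.exists_sum_spread_sq_le {V : Type*} [NormedAddCommGroup V]
    [NormedSpace ℝ V] {A : ℕ → Matrix (Fin m) (Fin m) ℝ} (hA : NetworkAssumptions A)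
    {x e : ℕ → Fin m → V} (hx : ∀ k, x (k + 1) = average (A k) (x k) + e k) :
    ∃ M, 0 < M ∧ ∀ N, ∑ k ∈ Finset.range (N + 1), spread (x k) ^ 2 ≤
      M * (1 + ∑ k ∈ Finset.range N, ‖e k‖ ^ 2) := by
  obtain ⟨S, δ, hδ, hδ1, hΦ⟩ := hA.exists_window
  refine exists_sum_le_of_window_contraction (S := S) (δ := δ) (C := (1 + 1 / δ) * (4 * (S + 1)))
    (fun k => sq_nonneg _) (fun k => sq_nonneg _) hδ hδ1.le (by positivity) fun k => ?_
  obtain ⟨w, hw, hle⟩ := exists_eq_average_transition_add hA.doubly_stochastic hx k (S + 1)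
  have h1 := spread_add_le (average (transition A k (S + 1)) (x k)) w
  rw [← hw] at h1
  have h2 := spread_average_le hδ.le (hΦ k) (fun i => sum_col_of_mem_doublyStochastic
    (transition_mem hA.doubly_stochastic k (S + 1)) i) (x k)
  have h3 : (∑ r ∈ Finset.range (S + 1), ‖e (k + r)‖) ^ 2 ≤
      (S + 1) * ∑ r ∈ Finset.range (S + 1), ‖e (k + r)‖ ^ 2 := by
    simpa using sq_sum_le_card_mul_sum_sq (s := Finset.range (S + 1)) (f := fun r => ‖e (k + r)‖)
  set D := spread (x k)
  set W := ∑ r ∈ Finset.range (S + 1), ‖e (k + r)‖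
  have hD : 0 ≤ D := spread_nonneg _
  have hW : 0 ≤ W := (norm_nonneg w).trans hle
  have h4 : spread (x (k + (S + 1))) ≤ (1 - δ) * D + 2 * W := by linarith
  have young : ((1 - δ) * D + 2 * W) ^ 2 ≤ (1 - δ) * D ^ 2 + (1 + 1 / δ) * 4 * W ^ 2 := by
    have h5 : 0 ≤ (δ * (1 - δ) * D - 2 * W) ^ 2 / δ := by positivity
    have h6 : (1 - δ) * D ^ 2 + (1 + 1 / δ) * 4 * W ^ 2 - ((1 - δ) * D + 2 * W) ^ 2 =
        (δ * (1 - δ) * D - 2 * W) ^ 2 / δ + δ ^ 2 * (1 - δ) * D ^ 2 := by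
      field_simp
      ring
    have h7 : 0 ≤ δ ^ 2 * (1 - δ) * D ^ 2 :=
      mul_nonneg (mul_nonneg (sq_nonneg _) (by linarith)) (sq_nonneg _)
    linarith
  calc spread (x (k + (S + 1))) ^ 2 ≤ ((1 - δ) * D + 2 * W) ^ 2 :=
        pow_le_pow_left₀ (spread_nonneg _) h4 2
    _ ≤ _ := young
    _ ≤ _ := by
        rw [mul_assoc (1 + 1 / δ), mul_assoc (1 + 1 / δ), mul_assoc (4 : ℝ)]
        gcongr

end Consensus

section Geometry

lemma exists_lipschitz_bound {n : ℕ} {h : EuclideanSpace ℝ (Fin n) → ℝ}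
    (hh : ConvexOn ℝ Set.univ h) (R : ℝ) :
    ∃ K, 0 ≤ K ∧ (∀ x ∈ Metric.closedBall 0 R, ∀ y ∈ Metric.closedBall 0 R,
      |h x - h y| ≤ K * ‖x - y‖) ∧
      ∀ x ∈ Metric.closedBall 0 R, ∀ g ∈ subdifferential h x, ‖g‖ ≤ K := by
  obtain ⟨K, hK⟩ := hh.locallyLipschitz.locallyLipschitzOn.exists_lipschitzOnWith_of_compact
    (isCompact_closedBall (0 : EuclideanSpace ℝ (Fin n)) (R + 1))
  have hlip : ∀ x ∈ Metric.closedBall 0 (R + 1), ∀ y ∈ Metric.closedBall 0 (R + 1),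
      |h x - h y| ≤ K * ‖x - y‖ := fun x hx y hy => by
    simpa [Real.dist_eq, dist_eq_norm] using hK.dist_le_mul x hx y hy
  have hsub : Metric.closedBall (0 : EuclideanSpace ℝ (Fin n)) R ⊆ Metric.closedBall 0 (R + 1) :=
    Metric.closedBall_subset_closedBall (by linarith)
  refine ⟨K, K.2, fun x hx y hy => hlip x (hsub hx) y (hsub hy), fun x hx g hg => ?_⟩
  rcases eq_or_ne g 0 with rfl | hg0
  · simp
  have hpos : 0 < ‖g‖ := norm_pos_iff.2 hg0
  have hunit : ‖‖g‖⁻¹ • g‖ = 1 := norm_smul_inv_norm hg0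
  have hmem : x + ‖g‖⁻¹ • g ∈ Metric.closedBall (0 : EuclideanSpace ℝ (Fin n)) (R + 1) := by
    rw [mem_closedBall_zero_iff] at hx ⊢
    exact (norm_add_le _ _).trans (by rw [hunit]; linarith)
  have h1 := hg (x + ‖g‖⁻¹ • g)
  have h2 := (abs_le.1 (hlip _ hmem x (hsub hx))).2
  rw [add_sub_cancel_left, inner_smul_right, real_inner_self_eq_norm_sq] at h1
  rw [add_sub_cancel_left, hunit] at h2
  have h3 : ‖g‖⁻¹ * ‖g‖ ^ 2 = ‖g‖ := by field_simp
  linarith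

variable {V : Type*} [NormedAddCommGroup V] [InnerProductSpace ℝ V]

/-- The three-point inequality for the minimiser `p` of the proximal objective over a convex set. -/
lemma prox_three_point {X : Set V} (hX : Convex ℝ X) {d z p y : V} {c : ℝ} (hc : 0 < c)
    (hp : p ∈ X) (hy : y ∈ X)
    (hmin : ∀ ξ ∈ X, inner ℝ d p + 1 / (2 * c) * ‖z - p‖ ^ 2 ≤
      inner ℝ d ξ + 1 / (2 * c) * ‖z - ξ‖ ^ 2) :
    2 * c * inner ℝ d (p - y) + ‖p - z‖ ^ 2 + ‖p - y‖ ^ 2 ≤ ‖z - y‖ ^ 2 := by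
  have hseg : ∀ t : ℝ, 0 < t → t ≤ 1 →
      0 ≤ 2 * c * inner ℝ d (y - p) - 2 * inner ℝ (z - p) (y - p) + t * ‖y - p‖ ^ 2 := by
    intro t ht ht1
    have h := hmin _ (hX.add_smul_sub_mem hp hy ⟨ht.le, ht1⟩)
    have h1 : z - (p + t • (y - p)) = (z - p) - t • (y - p) := by abel
    rw [h1, norm_sub_sq_real (z - p), inner_add_right, inner_smul_right, inner_smul_right, norm_smul,
      Real.norm_of_nonneg ht.le] at h
    have h2 : 0 ≤ t * (2 * c * inner ℝ d (y - p) - 2 * inner ℝ (z - p) (y - p) +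
        t * ‖y - p‖ ^ 2) := by
      have h3 := mul_le_mul_of_nonneg_left h (by positivity : 0 ≤ 2 * c)
      have h4 : ∀ a b : ℝ, 2 * c * (a + 1 / (2 * c) * b) = 2 * c * a + b := fun a b => by
        field_simp
      rw [h4, h4] at h3
      linarith
    exact nonneg_of_mul_nonneg_right h2 ht
  have hvar : 0 ≤ 2 * c * inner ℝ d (y - p) - 2 * inner ℝ (z - p) (y - p) := by
    have hlim : Tendsto (fun t : ℝ => 2 * c * inner ℝ d (y - p) - 2 * inner ℝ (z - p) (y - p) +
        t * ‖y - p‖ ^ 2) (𝓝[>] 0)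
        (𝓝 (2 * c * inner ℝ d (y - p) - 2 * inner ℝ (z - p) (y - p) + 0 * ‖y - p‖ ^ 2)) :=
      (Continuous.tendsto (by fun_prop) _).mono_left nhdsWithin_le_nhds
    rw [zero_mul, add_zero] at hlim
    refine ge_of_tendsto hlim ?_
    filter_upwards [Ioc_mem_nhdsGT (zero_lt_one' ℝ)] with t ht using hseg t ht.1 ht.2
  have hexp : ‖z - y‖ ^ 2 = ‖z - p‖ ^ 2 - 2 * inner ℝ (z - p) (y - p) + ‖y - p‖ ^ 2 := by
    rw [← norm_sub_sq_real]; congr 2; abel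
  rw [← neg_sub y p, inner_neg_right, norm_neg, norm_sub_rev p z, hexp]
  linarith

/-- If convex sets share a ball, then near points of each of them lies a common point. -/
lemma exists_common_point_near {ι : Type*} [Fintype ι] [Nonempty ι] {X : ι → Set V}
    (hX : ∀ i, Convex ℝ (X i)) {a : V} {ρ R : ℝ} (hρ : 0 < ρ)
    (hball : ∀ i, Metric.closedBall a ρ ⊆ X i) {x : ι → V} (hx : ∀ i, x i ∈ X i)
    (hR : ∀ i, ‖a - x i‖ ≤ R) :
    ∃ v ∈ ⋂ i, X i, ∀ i, ‖x i - v‖ ≤ (1 + R / ρ) * spread x := by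
  obtain ⟨j⟩ := ‹Nonempty ι›
  have hD := spread_nonneg x
  set D := spread x
  have hDρ : 0 < D + ρ := by linarith
  refine ⟨x j + (D / (D + ρ)) • (a - x j), Set.mem_iInter.2 fun i => ?_, fun i => ?_⟩
  · have hij : ‖x j - x i‖ ≤ D := norm_sub_le_spread x j i
    have hb : a + (ρ / D) • (x j - x i) ∈ X i := by
      refine hball i ?_
      rw [mem_closedBall_iff_norm, add_sub_cancel_left, norm_smul,
        Real.norm_of_nonneg (by positivity)]
      rcases hD.eq_or_lt with h | h
      · simp [← h, hρ.le]
      · rw [div_mul_eq_mul_div, div_le_iff₀ h]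
        exact mul_le_mul_of_nonneg_left hij hρ.le
    have hmem := hX i (hx i) hb (a := ρ / (D + ρ)) (b := D / (D + ρ)) (by positivity)
      (by positivity) (by field_simp; ring)
    convert hmem using 1
    rcases hD.eq_or_lt with h | h
    · rw [← h, norm_le_zero_iff, sub_eq_zero] at hij
      rw [← h, hij]
      simp [hρ.ne']
    · have h1 : D / (D + ρ) * (ρ / D) = ρ / (D + ρ) := by field_simp
      have h2 : D / (D + ρ) = 1 - ρ / (D + ρ) := by field_simp; ring
      rw [smul_add, smul_smul, h1, h2]
      module
  · have h1 : x i - (x j + (D / (D + ρ)) • (a - x j)) =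
        (x i - x j) - (D / (D + ρ)) • (a - x j) := by abel
    have h2 : D / (D + ρ) ≤ D / ρ := div_le_div_of_nonneg_left hD hρ (by linarith)
    calc _ ≤ ‖x i - x j‖ + D / (D + ρ) * ‖a - x j‖ := by
          rw [h1]
          refine (norm_sub_le _ _).trans ?_
          rw [norm_smul, Real.norm_of_nonneg (by positivity)]
      _ ≤ D + D / ρ * R := add_le_add (norm_sub_le_spread x i j)
          (mul_le_mul h2 (hR j) (norm_nonneg _) (by positivity))
      _ = _ := by ring

end Geometry

section Sequences

lemma exists_tendsto_of_le_add_summable {u β : ℕ → ℝ} (hu : ∀ k, 0 ≤ u k) (hβ : ∀ k, 0 ≤ β k)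
    (hsum : Summable β) (h : ∀ k, u (k + 1) ≤ u k + β k) : ∃ l, Tendsto u atTop (𝓝 l) := by
  have hanti : Antitone fun k => u k - ∑ r ∈ Finset.range k, β r :=
    antitone_nat_of_succ_le fun k => by
      rw [Finset.sum_range_succ]
      linarith [h k]
  have hbdd : BddBelow (Set.range fun k => u k - ∑ r ∈ Finset.range k, β r) := by
    refine ⟨-∑' r, β r, ?_⟩
    rintro _ ⟨k, rfl⟩
    have := hsum.sum_le_tsum (Finset.range k) fun r _ => hβ r
    simp only
    linarith [hu k]
  refine ⟨_, ((tendsto_atTop_ciInf hanti hbdd).add hsum.hasSum.tendsto_sum_nat).congr fun k => ?_⟩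
  simp

lemma summable_of_perturbed_descent {u e s c Δ : ℕ → ℝ} {P M : ℝ} (hM0 : 0 < M)
    (hu : ∀ k, 0 ≤ u k) (hcΔ : ∀ k, 0 ≤ c k * Δ k) (hc : Summable fun k => c k ^ 2)
    (hstep : ∀ k, u (k + 1) + e k ^ 2 + 2 * (c k * Δ k) ≤ u k + c k * P * (s (k + 1) + e k))
    (hM : ∀ N, ∑ k ∈ Finset.range (N + 1), s k ^ 2 ≤
      M * (1 + ∑ k ∈ Finset.range N, e k ^ 2)) :
    Summable (fun k => s k ^ 2) ∧ Summable (fun k => c k * Δ k) ∧ ∃ l, Tendsto u atTop (𝓝 l) := by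
  set Q := ∑' k, c k ^ 2
  have hQ : ∀ N, ∑ k ∈ Finset.range N, c k ^ 2 ≤ Q := fun N =>
    hc.sum_le_tsum _ fun k _ => sq_nonneg _
  have hyoung : ∀ k, u (k + 1) + e k ^ 2 + 2 * (c k * Δ k) ≤
      u k + 1 / (4 * M) * s (k + 1) ^ 2 + 1 / 4 * e k ^ 2 + P ^ 2 * (1 + M) * c k ^ 2 := by
    intro k
    have h1 : 0 ≤ (s (k + 1) - 2 * M * P * c k) ^ 2 / (4 * M) := by positivity
    have h2 : (s (k + 1) - 2 * M * P * c k) ^ 2 / (4 * M) =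
        1 / (4 * M) * s (k + 1) ^ 2 + P ^ 2 * M * c k ^ 2 - c k * P * s (k + 1) := by
      field_simp
      ring
    nlinarith [hstep k, sq_nonneg (e k - 2 * P * c k)]
  have hsum : ∀ N, u N + ∑ k ∈ Finset.range N, e k ^ 2 + 2 * ∑ k ∈ Finset.range N, c k * Δ k ≤
      u 0 + 1 / (4 * M) * ∑ k ∈ Finset.range N, s (k + 1) ^ 2 +
        1 / 4 * ∑ k ∈ Finset.range N, e k ^ 2 +
        P ^ 2 * (1 + M) * ∑ k ∈ Finset.range N, c k ^ 2 := by
    intro N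
    induction N with
    | zero => simp
    | succ N ih =>
      simp only [Finset.sum_range_succ]
      linarith [hyoung N]
  have hs : ∀ N, ∑ k ∈ Finset.range N, s (k + 1) ^ 2 ≤
      M * (1 + ∑ k ∈ Finset.range N, e k ^ 2) := fun N => by
    have := hM N
    rw [Finset.sum_range_succ'] at this
    linarith [sq_nonneg (s 0)]
  have hbound : ∀ N, u N + 1 / 2 * ∑ k ∈ Finset.range N, e k ^ 2 +
      2 * ∑ k ∈ Finset.range N, c k * Δ k ≤ u 0 + 1 / 4 + P ^ 2 * (1 + M) * Q := by
    intro N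
    have h1 := mul_le_mul_of_nonneg_left (hs N) (by positivity : 0 ≤ 1 / (4 * M))
    have h2 := mul_le_mul_of_nonneg_left (hQ N) (by positivity : 0 ≤ P ^ 2 * (1 + M))
    have h3 : 1 / (4 * M) * (M * (1 + ∑ k ∈ Finset.range N, e k ^ 2)) =
        1 / 4 + 1 / 4 * ∑ k ∈ Finset.range N, e k ^ 2 := by
      field_simp
    linarith [hsum N]
  set B := u 0 + 1 / 4 + P ^ 2 * (1 + M) * Q
  have heN : ∀ N, 0 ≤ ∑ k ∈ Finset.range N, e k ^ 2 := fun N =>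
    Finset.sum_nonneg fun k _ => sq_nonneg _
  have hΔN : ∀ N, 0 ≤ ∑ k ∈ Finset.range N, c k * Δ k := fun N =>
    Finset.sum_nonneg fun k _ => hcΔ k
  have he' : Summable fun k => e k ^ 2 := by
    refine summable_of_sum_range_le (c := 2 * B) (fun k => sq_nonneg _) fun N => ?_
    linarith [hbound N, hu N, hΔN N]
  have hs' : Summable fun k => s k ^ 2 := by
    refine summable_of_sum_range_le (c := M * (1 + 2 * B)) (fun k => sq_nonneg _) fun N => ?_
    have h1 : ∑ k ∈ Finset.range N, s k ^ 2 ≤ ∑ k ∈ Finset.range (N + 1), s k ^ 2 := by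
      rw [Finset.sum_range_succ]
      linarith [sq_nonneg (s N)]
    refine h1.trans ((hM N).trans (mul_le_mul_of_nonneg_left ?_ hM0.le))
    linarith [hbound N, hu N, hΔN N]
  refine ⟨hs', summable_of_sum_range_le (c := B) hcΔ fun N => ?_, ?_⟩
  · linarith [hbound N, hu N, hΔN N, heN N]
  · refine exists_tendsto_of_le_add_summable hu (β := fun k =>
      1 / (4 * M) * s (k + 1) ^ 2 + P ^ 2 * (1 + M) * c k ^ 2)
      (fun k => by positivity) ?_ fun k => ?_
    · exact (((summable_nat_add_iff (f := fun k => s k ^ 2) 1).2 hs').mul_left _).add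
        (hc.mul_left _)
    · linarith [hyoung k, hcΔ k, sq_nonneg (e k)]

lemma frequently_lt_of_summable_mul {c Δ : ℕ → ℝ} (hc : ∀ k, 0 ≤ c k) (hcs : ¬ Summable c)
    (h : Summable fun k => c k * Δ k) {ε : ℝ} (hε : 0 < ε) : ∃ᶠ k in atTop, Δ k < ε := by
  intro hev
  refine hcs ?_
  refine Summable.of_norm_bounded_eventually_nat (h.mul_left ε⁻¹) ?_
  filter_upwards [hev] with k hk
  rw [Real.norm_of_nonneg (hc k), inv_mul_eq_div, le_div_iff₀ hε]
  exact mul_le_mul_of_nonneg_left (not_lt.1 hk) (hc k)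

lemma StepSizeAssumptions.pos {c : ℕ → ℝ} (hc : StepSizeAssumptions c) (k : ℕ) : 0 < c k := by
  refine (hc.nonneg k).lt_of_ne fun h => hc.not_summable ?_
  refine summable_of_hasFiniteSupport ((Set.finite_lt_nat k).subset fun l hl => ?_)
  by_contra hlk
  exact hl (le_antisymm ((hc.nonincreasing (not_lt.1 hlk)).trans h.ge) (hc.nonneg l))

end Sequences

section Step

variable {n m : ℕ}

/-- One iteration of the algorithm, measured against a feasible point `y`, with `v` a common feasible
point near the new iterates `p`. -/
lemma descent_step {f : Fin m → EuclideanSpace ℝ (Fin n) → ℝ}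
    {X : Fin m → Set (EuclideanSpace ℝ (Fin n))} (hX : ∀ i, Convex ℝ (X i))
    {B : Matrix (Fin m) (Fin m) ℝ} (hB : B ∈ doublyStochastic ℝ (Fin m))
    {c K r : ℝ} (hc : 0 < c) (hK : 0 ≤ K) {x g p : Fin m → EuclideanSpace ℝ (Fin n)}
    {v y : EuclideanSpace ℝ (Fin n)}
    (hg : ∀ i, g i ∈ subdifferential (f i) (average B x i)) (hgK : ∀ i, ‖g i‖ ≤ K)
    (hf : ∀ i, |f i v - f i (average B x i)| ≤ K * ‖v - average B x i‖)
    (hp : ∀ i, p i ∈ X i) (hy : ∀ i, y ∈ X i)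
    (hmin : ∀ i, ∀ ξ ∈ X i,
      inner ℝ (average B g i) (p i) + 1 / (2 * c) * ‖average B x i - p i‖ ^ 2 ≤
        inner ℝ (average B g i) ξ + 1 / (2 * c) * ‖average B x i - ξ‖ ^ 2)
    (hv : ∀ i, ‖p i - v‖ ≤ r) :
    ∑ i, ‖p i - y‖ ^ 2 + ‖p - average B x‖ ^ 2 + 2 * (c * (objective f v - objective f y)) ≤
      ∑ i, ‖x i - y‖ ^ 2 + c * (m * K) * (6 * r + 4 * ‖p - average B x‖) := by
  have h0 : ∀ i j, 0 ≤ B i j := fun i j => nonneg_of_mem_doublyStochastic hB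
  have hcol : ∀ i, ∑ j, B j i = 1 := sum_col_of_mem_doublyStochastic hB
  have hrow : ∀ j, ∑ i, B j i = 1 := sum_row_of_mem_doublyStochastic hB
  set z := average B x
  set E := ‖p - z‖
  have hE : ∀ i, ‖p i - z i‖ ≤ E := norm_le_pi_norm (p - z)
  have hEsq : E ^ 2 ≤ ∑ i, ‖p i - z i‖ ^ 2 := by
    have hnn : 0 ≤ ∑ i, ‖p i - z i‖ ^ 2 := Finset.sum_nonneg fun i _ => sq_nonneg _
    rw [← Real.sqrt_le_sqrt_iff hnn, Real.sqrt_sq (norm_nonneg _)]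
    refine (pi_norm_le_iff_of_nonneg (Real.sqrt_nonneg _)).2 fun i => Real.le_sqrt_of_sq_le ?_
    exact Finset.single_le_sum (f := fun i => ‖p i - z i‖ ^ 2) (fun i _ => sq_nonneg _)
      (Finset.mem_univ i)
  have hd : ∀ i, ‖average B g i‖ ≤ K := fun i =>
    (norm_le_pi_norm _ i).trans <| (norm_average_le h0 hcol g).trans <|
      (pi_norm_le_iff_of_nonneg hK).2 hgK
  have hagent : ∀ i, ‖p i - y‖ ^ 2 + ‖p i - z i‖ ^ 2 + 2 * c * inner ℝ (average B g i) (v - y) ≤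
      ‖z i - y‖ ^ 2 + 2 * c * (K * r) := by
    intro i
    have h1 := prox_three_point (hX i) hc (hp i) (hy i) (hmin i)
    have h2 : inner ℝ (average B g i) (p i - y) =
        inner ℝ (average B g i) (p i - v) + inner ℝ (average B g i) (v - y) := by
      rw [← inner_add_right, sub_add_sub_cancel]
    have h3 : -(K * r) ≤ inner ℝ (average B g i) (p i - v) :=
      (neg_le_neg (mul_le_mul (hd i) (hv i) (norm_nonneg _) hK)).trans
        (abs_le.1 (abs_real_inner_le_norm _ _)).1
    rw [h2] at h1
    have := mul_le_mul_of_nonneg_left h3 (by positivity : 0 ≤ 2 * c)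
    linarith
  have hsum_d : ∑ i, average B g i = ∑ j, g j := by
    simp only [average]
    rw [Finset.sum_comm]
    simp only [← Finset.sum_smul, hrow, one_smul]
  have hobj : objective f v - objective f y - m * (2 * K * (r + E)) ≤
      ∑ i, inner ℝ (average B g i) (v - y) := by
    rw [← sum_inner, hsum_d, sum_inner]
    have hi : ∀ i, f i v - f i y - 2 * K * (r + E) ≤ inner ℝ (g i) (v - y) := by
      intro i
      have h1 := hg i y
      have h2 := (abs_le.1 (hf i)).2
      have h3 : inner ℝ (g i) (v - y) = inner ℝ (g i) (v - z i) - inner ℝ (g i) (y - z i) := by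
        rw [← inner_sub_right, sub_sub_sub_cancel_right]
      have h4 : -(K * ‖v - z i‖) ≤ inner ℝ (g i) (v - z i) :=
        (neg_le_neg (mul_le_mul_of_nonneg_right (hgK i) (norm_nonneg _))).trans
          (abs_le.1 (abs_real_inner_le_norm _ _)).1
      have h5 : ‖v - z i‖ ≤ r + E := by
        have h6 := norm_sub_le_norm_sub_add_norm_sub v (p i) (z i)
        rw [norm_sub_rev v (p i)] at h6
        linarith [hv i, hE i]
      have h7 := mul_le_mul_of_nonneg_left h5 hK
      linarith
    have := Finset.sum_le_sum fun i (_ : i ∈ Finset.univ) => hi i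
    simpa [objective, Finset.sum_sub_distrib] using this
  have hsum := Finset.sum_le_sum fun i (_ : i ∈ Finset.univ) => hagent i
  simp only [Finset.sum_add_distrib, ← Finset.mul_sum, Finset.sum_const, Finset.card_univ,
    Fintype.card_fin, nsmul_eq_mul] at hsum
  have havg := sum_norm_average_sub_sq_le h0 hcol hrow x y
  have hobj' := mul_le_mul_of_nonneg_left hobj (by positivity : 0 ≤ 2 * c)
  linarith

end Step

section Convergence

variable {n m : ℕ} {f : Fin m → EuclideanSpace ℝ (Fin n) → ℝ}
  {X : Fin m → Set (EuclideanSpace ℝ (Fin n))} {A : ℕ → Matrix (Fin m) (Fin m) ℝ} {c : ℕ → ℝ}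
  {x z g d : ℕ → Fin m → EuclideanSpace ℝ (Fin n)}

lemma ProblemAssumptions.continuous_objective (h : ProblemAssumptions f X) :
    Continuous (objective f) :=
  continuous_finsetSum _ fun i _ => (h.convex_objective i).locallyLipschitz.continuous

lemma ProblemAssumptions.isCompact_iInter [Nonempty (Fin m)] (h : ProblemAssumptions f X) :
    IsCompact (⋂ i, X i) :=
  (h.compact_set (Classical.arbitrary _)).of_isClosed_subset
    (isClosed_iInter fun i => (h.compact_set i).isClosed) (Set.iInter_subset _ _)

lemma ProblemAssumptions.exists_isMinimiser [Nonempty (Fin m)] (h : ProblemAssumptions f X) :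
    ∃ y, IsMinimiser f X y := by
  obtain ⟨y, hy, hmin⟩ := h.isCompact_iInter.exists_isMinOn
    (h.interior_nonempty.mono interior_subset) h.continuous_objective.continuousOn
  exact ⟨y, hy, fun w hw => hmin hw⟩

lemma IsRun.mem (hrun : IsRun f X A c x z g d) (k : ℕ) (i : Fin m) : x k i ∈ X i := by
  cases k with
  | zero => exact hrun.init i
  | succ k => exact hrun.update_mem k i

lemma ProblemAssumptions.exists_feasible_near [Nonempty (Fin m)] (h : ProblemAssumptions f X) :
    ∃ μ, 0 ≤ μ ∧ ∀ w : Fin m → EuclideanSpace ℝ (Fin n), (∀ i, w i ∈ X i) →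
      ∃ v ∈ ⋂ i, X i, ∀ i, ‖w i - v‖ ≤ μ * spread w := by
  obtain ⟨a, ha⟩ := h.interior_nonempty
  obtain ⟨ρ, hρ, hball⟩ := Metric.nhds_basis_closedBall.mem_iff.1 (mem_interior_iff_mem_nhds.1 ha)
  obtain ⟨R, hR⟩ := (isCompact_iUnion h.compact_set).isBounded.subset_closedBall a
  have hR' : ∀ i, ∀ w ∈ X i, ‖a - w‖ ≤ R := fun i w hw => by
    rw [norm_sub_rev, ← mem_closedBall_iff_norm]
    exact hR (Set.mem_iUnion_of_mem i hw)
  have hR0 : 0 ≤ R := (norm_nonneg _).trans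
    (hR' (Classical.arbitrary _) a (Set.mem_iInter.1 (interior_subset ha) _))
  exact ⟨1 + R / ρ, by positivity, fun w hw => exists_common_point_near h.convex_set hρ
    (fun i => hball.trans (Set.iInter_subset X i)) hw fun i => hR' i _ (hw i)⟩

lemma ProblemAssumptions.exists_uniform_bound (h : ProblemAssumptions f X) :
    ∃ K, 0 ≤ K ∧ (∀ i, ∀ v ∈ convexHull ℝ (⋃ i, X i), ∀ w ∈ convexHull ℝ (⋃ i, X i),
      |f i v - f i w| ≤ K * ‖v - w‖) ∧
      ∀ i, ∀ v ∈ convexHull ℝ (⋃ i, X i), ∀ ξ ∈ subdifferential (f i) v, ‖ξ‖ ≤ K := by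
  obtain ⟨R, hR⟩ := (isCompact_iUnion h.compact_set).isBounded.subset_closedBall 0
  have hR' := convexHull_min hR (convex_closedBall 0 R)
  choose K hK0 hK using fun i => exists_lipschitz_bound (h.convex_objective i) R
  have hle : ∀ i, K i ≤ ∑ j, K j := fun i =>
    Finset.single_le_sum (fun j _ => hK0 j) (Finset.mem_univ i)
  refine ⟨∑ i, K i, Finset.sum_nonneg fun i _ => hK0 i, fun i v hv w hw => ?_, fun i v hv ξ hξ => ?_⟩
  · exact ((hK i).1 v (hR' hv) w (hR' hw)).trans
      (mul_le_mul_of_nonneg_right (hle i) (norm_nonneg _))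
  · exact ((hK i).2 v (hR' hv) ξ hξ).trans (hle i)

lemma average_mem_convexHull {B : Matrix (Fin m) (Fin m) ℝ} (hB : B ∈ doublyStochastic ℝ (Fin m))
    {w : Fin m → EuclideanSpace ℝ (Fin n)} (hw : ∀ i, w i ∈ X i) (i : Fin m) :
    average B w i ∈ convexHull ℝ (⋃ i, X i) :=
  (convex_convexHull ℝ _).sum_mem (fun _ _ => nonneg_of_mem_doublyStochastic hB)
    (sum_col_of_mem_doublyStochastic hB i)
    fun j _ => subset_convexHull ℝ _ (Set.mem_iUnion_of_mem j (hw j))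

/-- Near the iterates runs a feasible sequence along which the optimality gap is summable against
the step sizes, and the distances of the iterates to any minimiser converge. -/
lemma exists_feasible_sequence [Nonempty (Fin m)] (hfX : ProblemAssumptions f X)
    (hA : NetworkAssumptions A) (hc : StepSizeAssumptions c) (hrun : IsRun f X A c x z g d) :
    ∃ v : ℕ → EuclideanSpace ℝ (Fin n), (∀ k, v k ∈ ⋂ i, X i) ∧
      (∀ i, Tendsto (fun k => ‖x k i - v k‖) atTop (𝓝 0)) ∧
      ∀ y, IsMinimiser f X y →
        Summable (fun k => c k * (objective f (v (k + 1)) - objective f y)) ∧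
        ∃ l, Tendsto (fun k => ∑ i, ‖x k i - y‖ ^ 2) atTop (𝓝 l) := by
  obtain ⟨μ, hμ, hnear⟩ := hfX.exists_feasible_near
  obtain ⟨K, hK, hlip, hsub⟩ := hfX.exists_uniform_bound
  choose v hvX hv using fun k => hnear (x k) (hrun.mem k)
  have hz : ∀ k, z k = average (A k) (x k) := fun k => funext (hrun.average k)
  have hd : ∀ k, d k = average (A k) (g k) := fun k => funext (hrun.average_subgradient k)
  obtain ⟨M, hM0, hM⟩ := hA.exists_sum_spread_sq_le (x := x)
    (e := fun k => x (k + 1) - average (A k) (x k)) fun k => by abel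
  have hzmem : ∀ k i, average (A k) (x k) i ∈ convexHull ℝ (⋃ i, X i) := fun k =>
    average_mem_convexHull (hA.doubly_stochastic k) (hrun.mem k)
  have hvmem : ∀ k, v k ∈ convexHull ℝ (⋃ i, X i) := fun k => subset_convexHull ℝ _
    (Set.mem_iUnion_of_mem (Classical.arbitrary _) (Set.mem_iInter.1 (hvX k) _))
  have hsg : ∀ k i, g k i ∈ subdifferential (f i) (average (A k) (x k) i) := fun k i =>
    hz k ▸ hrun.subgradient k i
  have main : ∀ y, IsMinimiser f X y → Summable (fun k => spread (x k) ^ 2) ∧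
      Summable (fun k => c k * (objective f (v (k + 1)) - objective f y)) ∧
      ∃ l, Tendsto (fun k => ∑ i, ‖x k i - y‖ ^ 2) atTop (𝓝 l) := by
    intro y hy
    refine summable_of_perturbed_descent (u := fun k => ∑ i, ‖x k i - y‖ ^ 2)
      (e := fun k => ‖x (k + 1) - average (A k) (x k)‖) (s := fun k => spread (x k))
      (P := m * K * (6 * μ + 4)) hM0 (fun k => Finset.sum_nonneg fun i _ => sq_nonneg _)
      (fun k => mul_nonneg (hc.nonneg k) (sub_nonneg.2 (hy.2 _ (hvX _)))) hc.square_summable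
      (fun k => ?_) hM
    have h := descent_step hfX.convex_set (hA.doubly_stochastic k) (hc.pos k) hK (hsg k)
      (fun i => hsub i _ (hzmem k i) _ (hsg k i))
      (fun i => hlip i _ (hvmem (k + 1)) _ (hzmem k i)) (hrun.update_mem k)
      (Set.mem_iInter.1 hy.1) (fun i ξ hξ => by
        have := hrun.update_min k i ξ hξ
        rwa [hz, hd] at this) (hv (k + 1))
    refine h.trans (add_le_add_right ?_ _)
    rw [mul_assoc (c k), mul_assoc (c k), mul_assoc (m * K : ℝ)]
    refine mul_le_mul_of_nonneg_left (mul_le_mul_of_nonneg_left ?_ (by positivity)) (hc.nonneg k)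
    nlinarith [spread_nonneg (x (k + 1)),
      mul_nonneg hμ (norm_nonneg (x (k + 1) - average (A k) (x k)))]
  refine ⟨v, hvX, fun i => ?_, fun y hy => (main y hy).2⟩
  obtain ⟨y, hy⟩ := hfX.exists_isMinimiser
  have hs : Tendsto (fun k => spread (x k)) atTop (𝓝 0) := by
    have h := (main y hy).1.tendsto_atTop_zero.sqrt
    simpa [Real.sqrt_sq (spread_nonneg _)] using h
  refine squeeze_zero (fun k => norm_nonneg _) (fun k => hv k i) ?_
  simpa using hs.const_mul μ

end Convergence

end SubgradAvg

theorem theorem1 {n m : ℕ}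
    (f : Fin m → EuclideanSpace ℝ (Fin n) → ℝ)
    (X : Fin m → Set (EuclideanSpace ℝ (Fin n)))
    (A : ℕ → Matrix (Fin m) (Fin m) ℝ) (c : ℕ → ℝ)
    (hfX : SubgradAvg.ProblemAssumptions f X)
    (hA : SubgradAvg.NetworkAssumptions A)
    (hc : SubgradAvg.StepSizeAssumptions c)
    (x z g d : ℕ → Fin m → EuclideanSpace ℝ (Fin n))
    (hrun : SubgradAvg.IsRun f X A c x z g d) :
    ∃ xs : EuclideanSpace ℝ (Fin n), SubgradAvg.IsMinimiser f X xs ∧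
      ∀ i, Tendsto (fun k => ‖x k i - xs‖) atTop (𝓝 0) := by
  rcases isEmpty_or_nonempty (Fin m) with hm | hm
  · exact ⟨0, ⟨by simp, fun y _ => by simp [SubgradAvg.objective]⟩, fun i => hm.elim i⟩
  obtain ⟨v, hvX, hxv, hmin⟩ := SubgradAvg.exists_feasible_sequence hfX hA hc hrun
  obtain ⟨y, hy⟩ := hfX.exists_isMinimiser
  obtain ⟨φ, hφ, hφlt⟩ := extraction_forall_of_frequently fun n : ℕ =>
    SubgradAvg.frequently_lt_of_summable_mul hc.nonneg hc.not_summable (hmin y hy).1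
      (Nat.one_div_pos_of_nat (α := ℝ) (n := n))
  obtain ⟨xs, hxs, ψ, hψ, hlim⟩ := hfX.isCompact_iInter.tendsto_subseq fun k => hvX (φ k + 1)
  have hobj : SubgradAvg.objective f xs ≤ SubgradAvg.objective f y := by
    have h1 := (hfX.continuous_objective.tendsto xs).comp hlim
    have h2 := ((tendsto_one_div_add_atTop_nhds_zero_nat (𝕜 := ℝ)).comp hψ.tendsto_atTop).add_const
      (SubgradAvg.objective f y)
    rw [zero_add] at h2
    exact le_of_tendsto_of_tendsto' h1 h2 fun k => (sub_lt_iff_lt_add.1 (hφlt (ψ k))).le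
  have hxsmin : SubgradAvg.IsMinimiser f X xs := ⟨hxs, fun w hw => hobj.trans (hy.2 w hw)⟩
  refine ⟨xs, hxsmin, ?_⟩
  obtain ⟨l, hl⟩ := (hmin xs hxsmin).2
  have hθ : Tendsto (fun k => φ (ψ k) + 1) atTop atTop :=
    tendsto_atTop_mono (fun k => Nat.le_succ _) (hφ.comp hψ).tendsto_atTop
  have hsub : ∀ i, Tendsto (fun k => ‖x (φ (ψ k) + 1) i - xs‖) atTop (𝓝 0) := by
    intro i
    have h := ((hxv i).comp hθ).add (tendsto_iff_norm_sub_tendsto_zero.1 hlim)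
    rw [add_zero] at h
    exact squeeze_zero (fun k => norm_nonneg _)
      (fun k => norm_sub_le_norm_sub_add_norm_sub _ (v (φ (ψ k) + 1)) _) h
  have hl0 : l = 0 := by
    refine tendsto_nhds_unique (hl.comp hθ) ?_
    have h := tendsto_finsetSum Finset.univ fun i _ => (hsub i).pow 2
    simpa [Function.comp_def] using h
  subst hl0
  intro i
  have hsq : Tendsto (fun k => ‖x k i - xs‖ ^ 2) atTop (𝓝 0) :=
    squeeze_zero (fun k => sq_nonneg _) (fun k => Finset.single_le_sum
      (f := fun i => ‖x k i - xs‖ ^ 2) (fun i _ => sq_nonneg _) (Finset.mem_univ i)) hl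
  simpa [Real.sqrt_sq (norm_nonneg _)] using hsq.sqrt
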